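/- For a partition $\lambda$ of a non-negative integer $|\lambda|$ (the empty partition included) and an integer $t\ge 1$, let $\mathcal H_t(\lambda)$ be the multiset of those hook numbers of $\lambda$ that are multiples of $t$, and for $a\in\mathbb C$ put $$f_{a,t}(\lambda):=t^{a-1}\sum_{h\in\mathcal H_t(\lambda)}\frac1{h^a}.$$ For $z$ in the upper half-plane $\mathbb H$ put $q:=e^{2\pi i z}$, and for a complex-valued function $f$ on the set $\mathcal P$ of all partitions let $$\langle f\rangle_q:=\frac{\sum_{\lambda\in\mathcal P}f(\lambda)q^{|\lambda|}}{\sum_{\lambda\in\mathcal P}q^{|\lambda|}} .$$ Let $B_n$ be the Bernoulli numbers and, for an integer $k\ge1$, let $$P_{-2k}(z):=-\frac12(2\pi i)^{2k+1}\sum_{m=0}^{k+1}\frac{B_{2m}}{(2m)!}\,\frac{B_{2k+2-2m}}{(2k+2-2m)!}\,z^{2m-1},$$ $$M_{-2k,t}(z):=\langle f_{2k+2,t}\rangle_q+\frac12P_{-2k}(tz)+\frac12\zeta(2k+1).$$ **Theorem 1.3.** Let $k,t\ge 1$ be integers and $z\in\mathbb H$. The two series in $\langle f_{2k+2,t}\rangle_q$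 converge absolutely, the denominator is non-zero, and the following hold. (1) We have $$M_{-2k,t}(z+1)-M_{-2k,t}(z)=-\frac14(2\pi i)^{2k+1}\left(\sum_{m=1}^{k+1}\sum_{r=1}^{2m-1}\frac{B_{2m}}{(2m)!}\,\frac{B_{2k+2-2m}}{(2k+2-2m)!}\,t^{2m-1}\binom{2m-1}{r}z^{2m-1-r}-\frac{B_{2k+2}}{(2k+2)!}\cdot\frac1{t\,z(z+1)}\right).$$ (2) We have $$M_{-2k,t}(z)=(tz)^{2k}\,M_{-2k,t}\!\left(-\frac1{t^2z}\right).$$ -/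

import Mathlib

namespace HookBracket

/-- The Ferrers–Young diagram of a partition: its parts, in weakly decreasing order, are the
lengths of the rows. -/
def diagram {n : ℕ} (p : n.Partition) : YoungDiagram :=
  YoungDiagram.ofRowLens (p.parts.sort (· ≥ ·))
    (Multiset.pairwise_sort p.parts (· ≥ ·)).sortedGE

/-- The hook number of the cell `c = (i, j)` (row `i`, column `j`, counted from `0`) of a diagram:
the number of cells to its right in its row, plus the number of cells below it in its column,
plus one. -/
def hookLength (μ : YoungDiagram) (c : ℕ × ℕ) : ℕ :=
  (μ.rowLen c.1 - (c.2 + 1)) + (μ.colLen c.2 - (c.1 + 1)) + 1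

/-- The multiset of all hook numbers of a partition, one for each cell of its diagram. -/
def hooks {n : ℕ} (p : n.Partition) : Multiset ℕ :=
  (diagram p).cells.val.map (hookLength (diagram p))

/-- The multiset of those hook numbers of a partition that are multiples of `t`. -/
def tHooks (t : ℕ) {n : ℕ} (p : n.Partition) : Multiset ℕ :=
  (hooks p).filter (t ∣ ·)

/-- All integer partitions `⟨n, p⟩`, where `n` is the size of `p`; the empty partition, of size
`0`, is included. -/
abbrev AllPartitions : Type := Σ n : ℕ, n.Partition

/-- The weighted `t`-hook function `f_{a,t}(λ) = t^(a-1) ∑ 1 / h^a`, the sum running over the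
hook numbers `h` of `λ` that are multiples of `t`. -/
noncomputable def hookFun (a : ℂ) (t : ℕ) (p : AllPartitions) : ℂ :=
  (t : ℂ) ^ (a - 1) * ((tHooks t p.2).map (fun h : ℕ => 1 / (h : ℂ) ^ a)).sum

/-- The nome `q = exp(2πiz)`. -/
noncomputable def nome (z : ℂ) : ℂ :=
  Complex.exp (2 * (Real.pi : ℂ) * Complex.I * z)

/-- The `q`-bracket `(∑ f(λ) q^|λ|) / (∑ q^|λ|)`, both sums running over all partitions `λ`. -/
noncomputable def qBracket (f : AllPartitions → ℂ) (q : ℂ) : ℂ :=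
  (∑' p : AllPartitions, f p * q ^ p.1) / (∑' p : AllPartitions, q ^ p.1)

/-- `P_{-2k}(z) = -(1/2) (2πi)^(2k+1) ∑_{m=0}^{k+1}
B_{2m}/(2m)! · B_{2k+2-2m}/(2k+2-2m)! · z^(2m-1)`. -/
noncomputable def bernoulliP (k : ℕ) (z : ℂ) : ℂ :=
  -(1 / 2) * (2 * (Real.pi : ℂ) * Complex.I) ^ (2 * k + 1) *
    ∑ m ∈ Finset.range (k + 2),
      ((bernoulli (2 * m) : ℚ) : ℂ) / ((2 * m).factorial : ℂ) *
      (((bernoulli (2 * k + 2 - 2 * m) : ℚ) : ℂ) / ((2 * k + 2 - 2 * m).factorial : ℂ)) *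
      z ^ (2 * (m : ℤ) - 1)

/-- `M_{-2k,t}(z) = ⟨f_{2k+2,t}⟩_q + (1/2) P_{-2k}(tz) + (1/2) ζ(2k+1)` with `q = exp(2πiz)`. -/
noncomputable def hookM (k t : ℕ) (z : ℂ) : ℂ :=
  qBracket (hookFun (2 * (k : ℂ) + 2) t) (nome z) + 1 / 2 * bernoulliP k ((t : ℂ) * z) +
    1 / 2 * riemannZeta (2 * (k : ℂ) + 1)

end HookBracket

namespace HookBracket

open Finset Filter Topology

/-! ### Beta-sets of Young diagrams -/

/-! The theorem reduces to Ramanujan's formula for odd zeta values. Encode a partition by its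
beta-set: hooks of length `h` become beads that can slide down `h` places onto a gap
(`count_hooks`). Sliding down inverts sliding up, and a beta-set with enough beads has exactly `h`
more upward moves than downward ones. This gives the recursion `hookTotal_add`, so the generating
function of `h`-hooks is `h q^h / (1 - q^h)` times that of partitions. Summing over `h = tm` with
the given weights, the powers of `t` cancel and the bracket is a Lambert series at `q^t`
(`qBracket_hookFun`); thus everything depends only on `tz`.

Convergence comes from the same recursion: the hooks of all partitions of `n` number `n p(n)`, which
bounds `p(n)` inductively. The denominator is non-zero because stripping Euler factors leaves series
tending to 1.

For inversion, the Lambert series is a cotangent series, hence by partial fractions a double series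
over `(n, m)`. Under `z ↦ -1/z` with `n` and `m` swapped, its terms differ by a finite geometric
sum, which sums to products of even zeta values, i.e. to `bernoulliP` (`cotSeries_sub`,
`bernoulliP_eq`). That polynomial is itself antisymmetric under inversion, so adding half of it
absorbs the defect exactly. For translation, the Lambert part is periodic and only `bernoulliP`
changes. -/

/-- The set of first column hook lengths of a Young diagram padded by empty rows to `N` rows. -/
def betaSet (N : ℕ) (μ : YoungDiagram) : Finset ℕ :=
  (range N).image fun k => μ.rowLen (N - 1 - k) + k

theorem strictMono_rowLen_add (N : ℕ) (μ : YoungDiagram) :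
    StrictMono fun k => μ.rowLen (N - 1 - k) + k := by
  intro a b hab
  have := μ.rowLen_anti (N - 1 - b) (N - 1 - a) (by omega)
  dsimp only
  omega

theorem card_betaSet (N : ℕ) (μ : YoungDiagram) : (betaSet N μ).card = N := by
  rw [betaSet, card_image_of_injective _ (strictMono_rowLen_add N μ).injective, card_range]

theorem rowLen_eq_zero {μ : YoungDiagram} {i : ℕ} (h : μ.colLen 0 ≤ i) : μ.rowLen i = 0 := by
  by_contra h0
  have := YoungDiagram.mem_iff_lt_colLen.1
    (YoungDiagram.mem_iff_lt_rowLen.2 (Nat.pos_of_ne_zero h0) : (i, 0) ∈ μ)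
  omega

theorem card_eq_sum_rowLen {μ : YoungDiagram} {N : ℕ} (h : μ.colLen 0 ≤ N) :
    μ.card = ∑ i ∈ range N, μ.rowLen i := by
  rw [YoungDiagram.card, card_eq_sum_card_fiberwise (f := Prod.fst) (t := range N)]
  · exact sum_congr rfl fun i _ => (μ.rowLen_eq_card).symm
  · rintro ⟨i, j⟩ hc
    have h1 : j < μ.rowLen i := YoungDiagram.mem_iff_lt_rowLen.1 hc
    simp only [coe_range, Set.mem_Iio]
    by_contra h2
    have := rowLen_eq_zero (μ := μ) (i := i) (by omega)
    omega

theorem colLen_zero_le_card (μ : YoungDiagram) : μ.colLen 0 ≤ μ.card := by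
  rw [YoungDiagram.colLen_eq_card]
  exact card_le_card (filter_subset _ _)

theorem sum_betaSet {μ : YoungDiagram} {N : ℕ} (h : μ.colLen 0 ≤ N) :
    ∑ x ∈ betaSet N μ, x = μ.card + ∑ i ∈ range N, i := by
  rw [betaSet, sum_image fun _ _ _ _ e => (strictMono_rowLen_add N μ).injective e,
    sum_add_distrib, sum_range_reflect (fun i => μ.rowLen i), card_eq_sum_rowLen h]

theorem betaSet_inj {μ ν : YoungDiagram} {N : ℕ} (hμ : μ.colLen 0 ≤ N) (hν : ν.colLen 0 ≤ N)
    (h : betaSet N μ = betaSet N ν) : μ = ν := by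
  have key (ρ : YoungDiagram) :
      (fun k : Fin N => ρ.rowLen (N - 1 - k) + k) =
        (betaSet N ρ).orderEmbOfFin (card_betaSet N ρ) :=
    orderEmbOfFin_unique _ (fun k => mem_image_of_mem _ (mem_range.2 k.2))
      fun a b hab => strictMono_rowLen_add N ρ hab
  have h2 : (fun k : Fin N => μ.rowLen (N - 1 - k) + k) =
      fun k : Fin N => ν.rowLen (N - 1 - k) + k := by
    rw [key, key]
    simp only [h]
  have h3 (i : ℕ) : μ.rowLen i = ν.rowLen i := by
    rcases lt_or_ge i N with hi | hi
    · have := congrFun h2 ⟨N - 1 - i, by omega⟩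
      simpa [show N - 1 - (N - 1 - i) = i by omega] using this
    · rw [rowLen_eq_zero (hμ.trans hi), rowLen_eq_zero (hν.trans hi)]
  ext ⟨i, j⟩
  simp only [YoungDiagram.mem_cells, YoungDiagram.mem_iff_lt_rowLen, h3]

/-- Subtracting `k` from the `k`-th smallest element of `X` leaves a weakly increasing sequence;
read backwards, it gives the row lengths. -/
theorem exists_betaSet_eq {N : ℕ} {X : Finset ℕ} (hX : X.card = N) :
    ∃ μ : YoungDiagram, μ.colLen 0 ≤ N ∧ betaSet N μ = X := by
  set f := X.orderEmbOfFin hX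
  have hf (d : ℕ) (a b : Fin N) (hab : (a : ℕ) + d = b) : f a + d ≤ f b := by
    induction d generalizing b with
    | zero =>
      obtain rfl : a = b := Fin.ext hab
      simp
    | succ d ih =>
      have h1 := ih ⟨a + d, by omega⟩ rfl
      have h2 : f ⟨a + d, by omega⟩ < f b := f.strictMono (Fin.lt_def.2 (by simp; omega))
      omega
  set w : List ℕ := List.ofFn fun i : Fin N => f i.rev - i.rev with hw
  have hs : w.SortedGE := by
    apply List.Pairwise.sortedGE
    rw [hw, List.pairwise_ofFn]
    intro i j hij
    have h1 := hf ((i.rev : ℕ) - j.rev) j.rev i.rev (by simp [Fin.val_rev]; omega)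
    have h2 : (j.rev : ℕ) ≤ i.rev := by simp [Fin.val_rev]; omega
    simp only [ge_iff_le]
    omega
  refine ⟨YoungDiagram.ofRowLens w hs, ?_, ?_⟩
  · by_contra! h
    have := YoungDiagram.mem_ofRowLens.1 (YoungDiagram.mem_iff_lt_colLen.2 h)
    simp [hw] at this
  · refine eq_of_subset_of_card_le ?_ (by rw [card_betaSet, hX])
    intro x hx
    obtain ⟨k, hk, rfl⟩ := mem_image.1 hx
    have hk := mem_range.1 hk
    have h1 := YoungDiagram.rowLen_ofRowLens (hw := hs) ⟨N - 1 - k, by simp [hw]; omega⟩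
    have h2 : w[N - 1 - k]'(by simp [hw]; omega) = f ⟨k, hk⟩ - k := by
      have : Fin.rev (⟨N - 1 - k, by omega⟩ : Fin N) = ⟨k, hk⟩ :=
        Fin.ext (by simp [Fin.val_rev]; omega)
      simp only [hw, List.getElem_ofFn, this]
    have h3 := hf k ⟨0, by omega⟩ ⟨k, hk⟩ (by simp)
    simp only [Fin.getElem_fin] at h1
    rw [h1, h2, Nat.sub_add_cancel (by omega)]
    exact orderEmbOfFin_mem X hX _

/-! ### Partitions and their diagrams -/

theorem sum_rowLens (μ : YoungDiagram) : μ.rowLens.sum = μ.card := by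
  rw [card_eq_sum_rowLen le_rfl, YoungDiagram.rowLens, sum_range, ← List.sum_ofFn,
    List.ofFn_eq_map, ← List.map_coe_finRange_eq_range, List.map_map]
  rfl

theorem rowLens_diagram {n : ℕ} (p : n.Partition) :
    (diagram p).rowLens = p.parts.sort (· ≥ ·) :=
  YoungDiagram.rowLens_ofRowLens_eq_self fun _ hx => p.parts_pos ((Multiset.mem_sort _).1 hx)

theorem card_diagram {n : ℕ} (p : n.Partition) : (diagram p).card = n := by
  have h : (diagram p).rowLens.sum = n := by
    rw [rowLens_diagram, ← Multiset.sum_coe, Multiset.sort_eq, p.parts_sum]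
  rw [← sum_rowLens, h]

theorem diagram_injective (n : ℕ) : Function.Injective (diagram (n := n)) := by
  intro p p' h
  have := congrArg (fun μ => (μ.rowLens : Multiset ℕ)) h
  simp only [rowLens_diagram, Multiset.sort_eq] at this
  exact Nat.Partition.ext this

theorem exists_diagram_eq (μ : YoungDiagram) : ∃ p : μ.card.Partition, diagram p = μ := by
  refine ⟨⟨μ.rowLens, fun h => μ.pos_of_mem_rowLens _ h, ?_⟩, ?_⟩
  · rw [Multiset.sum_coe, sum_rowLens]
  · have : (Multiset.sort (μ.rowLens : Multiset ℕ) (· ≥ ·)) = μ.rowLens := by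
      rw [Multiset.coe_sort]
      exact List.mergeSort_eq_self _ (by simpa using μ.rowLens_sorted.pairwise)
    simp only [diagram, this]
    exact YoungDiagram.ofRowLens_to_rowLens_eq_self

/-- The beta-sets with `N` beads of the partitions of `n`. -/
def betaSets (N n : ℕ) : Finset (Finset ℕ) :=
  univ.image fun p : n.Partition => betaSet N (diagram p)

theorem colLen_diagram_le {n : ℕ} (p : n.Partition) : (diagram p).colLen 0 ≤ n :=
  (colLen_zero_le_card _).trans (card_diagram p).le

/-- This makes bead moves easy to check: only cardinality and sum matter. A partition of `n` has at
most `n` rows, so `N ≥ n` beads suffice. -/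
theorem mem_betaSets {N n : ℕ} (h : n ≤ N) {X : Finset ℕ} :
    X ∈ betaSets N n ↔ X.card = N ∧ ∑ x ∈ X, x = n + ∑ i ∈ range N, i := by
  constructor
  · rintro hX
    obtain ⟨p, -, rfl⟩ := mem_image.1 hX
    refine ⟨card_betaSet _ _, ?_⟩
    rw [sum_betaSet ((colLen_diagram_le p).trans h), card_diagram]
  · rintro ⟨h1, h2⟩
    obtain ⟨μ, hμ, rfl⟩ := exists_betaSet_eq h1
    rw [sum_betaSet hμ] at h2
    obtain rfl : μ.card = n := by omega
    obtain ⟨p, hp⟩ := exists_diagram_eq μ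
    exact mem_image.2 ⟨p, mem_univ _, by rw [hp]⟩

theorem sum_betaSets {M : Type*} [AddCommMonoid M] {N n : ℕ} (h : n ≤ N) (g : Finset ℕ → M) :
    ∑ X ∈ betaSets N n, g X = ∑ p : n.Partition, g (betaSet N (diagram p)) :=
  sum_image fun p _ p' _ e => diagram_injective n
    (betaSet_inj ((colLen_diagram_le p).trans h) ((colLen_diagram_le p').trans h) e)

/-! ### Moving beads -/

/-- The beads that can be moved down by `h`. -/
def removable (h : ℕ) (X : Finset ℕ) : Finset ℕ := X.filter fun x => h ≤ x ∧ x - h ∉ X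

/-- The beads that can be moved up by `h`. -/
def addable (h : ℕ) (X : Finset ℕ) : Finset ℕ := X.filter fun x => x + h ∉ X

/-- Pairs of beads at distance `h` are counted equally by their lower and upper members. The
non-addable beads are the lower members; the beads at height at least `h` that are not removable are
the upper ones. The excess is the `h` beads below `h`. -/
theorem card_addable {h : ℕ} {X : Finset ℕ} (hX : range h ⊆ X) :
    (addable h X).card = (removable h X).card + h := by
  have h1 := card_filter_add_card_filter_not (s := X) (fun x => x + h ∈ X)
  have h2 := card_filter_add_card_filter_not (s := X) (fun x => h ≤ x)
  have h3 := card_filter_add_card_filter_not (s := X.filter (h ≤ ·)) (fun x => x - h ∈ X)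
  have h4 : X.filter (fun x => ¬ h ≤ x) = range h := by
    ext x
    simp only [mem_filter, mem_range, not_le]
    exact ⟨fun hx => hx.2, fun hx => ⟨hX (mem_range.2 hx), hx⟩⟩
  have h5 : (X.filter fun x => x + h ∈ X).card =
      ((X.filter (h ≤ ·)).filter fun x => x - h ∈ X).card := by
    refine card_nbij' (· + h) (· - h) ?_ ?_ ?_ ?_
    · intro x hx
      simp only [coe_filter, Set.mem_ofPred_eq, mem_filter] at hx ⊢
      simpa using hx.symm
    · intro x hx
      simp only [coe_filter, Set.mem_ofPred_eq, mem_filter] at hx ⊢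
      rw [Nat.sub_add_cancel hx.1.2]
      exact ⟨hx.2, hx.1.1⟩
    · intro x _
      simp
    · intro x hx
      simp only [coe_filter, Set.mem_ofPred_eq, mem_filter] at hx ⊢
      exact Nat.sub_add_cancel hx.1.2
  rw [h4, card_range] at h2
  rw [filter_filter, filter_filter] at h3
  rw [filter_filter] at h5
  simp only [addable, removable]
  omega

theorem sum_insert_erase {X : Finset ℕ} {x y : ℕ} (hx : x ∈ X) (hy : y ∉ X) :
    ∑ i ∈ insert y (X.erase x), i + x = ∑ i ∈ X, i + y := by
  rw [sum_insert fun h => hy (mem_of_mem_erase h), add_assoc, sum_erase_add _ _ hx, add_comm]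

theorem card_insert_erase {X : Finset ℕ} {x y : ℕ} (hx : x ∈ X) (hy : y ∉ X) :
    (insert y (X.erase x)).card = X.card := by
  rw [card_insert_of_notMem fun h => hy (mem_of_mem_erase h), card_erase_add_one hx]

theorem insert_erase_insert_erase {X : Finset ℕ} {x y : ℕ} (hx : x ∈ X) (hy : y ∉ X) :
    insert x ((insert y (X.erase x)).erase y) = X := by
  rw [erase_insert fun h => hy (mem_of_mem_erase h), insert_erase hx]

/-- Sliding the marked bead down by `h` is a bijection, with sliding up as its inverse; both sides
use the same number of beads. -/
theorem sum_card_removable {N n h : ℕ} (hn : n + h ≤ N) (hh : 0 < h) :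
    ∑ X ∈ betaSets N (n + h), (removable h X).card = ∑ X ∈ betaSets N n, (addable h X).card := by
  rw [← card_sigma, ← card_sigma]
  refine card_nbij' (fun a => ⟨insert (a.2 - h) (a.1.erase a.2), a.2 - h⟩)
    (fun a => ⟨insert (a.2 + h) (a.1.erase a.2), a.2 + h⟩) ?_ ?_ ?_ ?_
  · rintro ⟨X, x⟩ hX
    simp only [coe_sigma, Set.mem_sigma_iff, mem_coe, removable, mem_filter, addable,
      mem_betaSets hn, mem_betaSets (show n ≤ N by omega)] at hX ⊢
    obtain ⟨⟨h1, h2⟩, h3, h4, h5⟩ := hX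
    have h6 := sum_insert_erase h3 h5
    refine ⟨⟨(card_insert_erase h3 h5).trans h1, by omega⟩, mem_insert_self _ _, ?_⟩
    rw [Nat.sub_add_cancel h4, mem_insert, mem_erase]
    omega
  · rintro ⟨X, x⟩ hX
    simp only [coe_sigma, Set.mem_sigma_iff, mem_coe, removable, mem_filter, addable,
      mem_betaSets hn, mem_betaSets (show n ≤ N by omega)] at hX ⊢
    obtain ⟨⟨h1, h2⟩, h3, h5⟩ := hX
    have h6 := sum_insert_erase h3 h5
    refine ⟨⟨(card_insert_erase h3 h5).trans h1, by omega⟩, mem_insert_self _ _, by omega, ?_⟩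
    rw [Nat.add_sub_cancel, mem_insert, mem_erase]
    omega
  · rintro ⟨X, x⟩ hX
    simp only [coe_sigma, Set.mem_sigma_iff, mem_coe, removable, mem_filter] at hX ⊢
    obtain ⟨-, h3, h4, h5⟩ := hX
    rw [Nat.sub_add_cancel h4, insert_erase_insert_erase h3 h5]
  · rintro ⟨X, x⟩ hX
    simp only [coe_sigma, Set.mem_sigma_iff, mem_coe, addable, mem_filter] at hX ⊢
    obtain ⟨-, h3, h5⟩ := hX
    rw [Nat.add_sub_cancel, insert_erase_insert_erase h3 h5]

/-- A move would produce `N` distinct naturals with sum below `0 + 1 + ⋯ + (N - 1)`. -/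
theorem removable_eq_empty {N n h : ℕ} (hn : n ≤ N) (hh : n < h) {X : Finset ℕ}
    (hX : X ∈ betaSets N n) : removable h X = ∅ := by
  by_contra hne
  obtain ⟨x, hx⟩ := nonempty_iff_ne_empty.2 hne
  obtain ⟨h3, h4, h5⟩ := mem_filter.1 hx
  obtain ⟨h1, h2⟩ := (mem_betaSets hn).1 hX
  have h6 := sum_insert_erase h3 h5
  obtain ⟨μ, hμ, hμX⟩ := exists_betaSet_eq ((card_insert_erase h3 h5).trans h1)
  have := sum_betaSet hμ
  rw [hμX] at this
  omega

theorem range_subset_betaSet {μ : YoungDiagram} {N h : ℕ} (hN : μ.colLen 0 + h ≤ N) :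
    range h ⊆ betaSet N μ := by
  intro x hx
  have hx := mem_range.1 hx
  exact mem_image.2 ⟨x, mem_range.2 (by omega), by rw [rowLen_eq_zero (by omega), zero_add]⟩

/-! ### Hooks and beads -/

/-- The bead of row `i` lies above the gap of column `j` when `(i, j)` is a cell, and below it
otherwise. -/
theorem rowLen_add_ne {μ : YoungDiagram} {N i j : ℕ} (hN : μ.colLen 0 ≤ N)
    (hi : i < N) : μ.rowLen i + (N - 1 - i) ≠ N + j - μ.colLen j := by
  have h0 := μ.colLen_anti 0 j (by omega)
  have h1 : i < μ.colLen j ↔ j < μ.rowLen i := by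
    rw [← YoungDiagram.mem_iff_lt_colLen, YoungDiagram.mem_iff_lt_rowLen]
  omega

theorem colGap_notMem_betaSet {μ : YoungDiagram} {N : ℕ} (hN : μ.colLen 0 ≤ N) (j : ℕ) :
    N + j - μ.colLen j ∉ betaSet N μ := by
  intro h
  obtain ⟨k, hk, hk'⟩ := mem_image.1 h
  have hk := mem_range.1 hk
  refine rowLen_add_ne (i := N - 1 - k) (j := j) hN (by omega) ?_
  rw [← hk']
  omega

theorem exists_colGap_eq {μ : YoungDiagram} {N y : ℕ} (hN : μ.colLen 0 ≤ N)
    (hy : y ∉ betaSet N μ) : ∃ j, y = N + j - μ.colLen j := by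
  have hne (i : ℕ) (hi : i < N) : μ.rowLen i + (N - 1 - i) ≠ y := by
    intro h
    refine hy (mem_image.2 ⟨N - 1 - i, mem_range.2 (by omega), ?_⟩)
    rw [show N - 1 - (N - 1 - i) = i by omega]
    exact h
  have hex : ∃ i, N ≤ i ∨ μ.rowLen i + (N - 1 - i) < y := ⟨N, Or.inl le_rfl⟩
  classical
  -- `i` counts the beads above the gap `y`; the column sought is then `y + i - N`, whose length is
  -- `i`.
  set i := Nat.find hex with hi
  have hmin (i' : ℕ) (h : i' < i) : i' < N ∧ y < μ.rowLen i' + (N - 1 - i') := by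
    have := Nat.find_min hex h
    push Not at this
    exact ⟨this.1, lt_of_le_of_ne this.2 (hne i' this.1).symm⟩
  have hiN : i ≤ N := Nat.find_min' hex (Or.inl le_rfl)
  have hlt : μ.rowLen i + N ≤ y + i := by
    rcases Nat.find_spec hex with h | h
    · rw [← hi] at h
      rw [rowLen_eq_zero (hN.trans h)]
      omega
    · rw [← hi] at h
      omega
  refine ⟨y + i - N, ?_⟩
  have hcol : μ.colLen (y + i - N) = i := by
    apply le_antisymm
    · by_contra! h
      have := YoungDiagram.mem_iff_lt_rowLen.1 (YoungDiagram.mem_iff_lt_colLen.2 h)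
      omega
    · rcases Nat.eq_zero_or_pos i with h | h
      · omega
      · have h1 := hmin (i - 1) (by omega)
        have := YoungDiagram.mem_iff_lt_colLen.1
          (YoungDiagram.mem_iff_lt_rowLen.2 (show y + i - N < μ.rowLen (i - 1) by omega))
        omega
  rw [hcol]
  omega

/-- The hook number of `(i, j)` is the bead of row `i` minus the gap of column `j`, so a cell with
hook `h` amounts to a bead with a gap `h` places below it. -/
theorem count_hooks {n : ℕ} (p : n.Partition) {N h : ℕ} (hN : n ≤ N) (hh : 0 < h) :
    (hooks p).count h = (removable h (betaSet N (diagram p))).card := by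
  have hN := (colLen_diagram_le p).trans hN
  set μ := diagram p
  have hcell {i j : ℕ} (hc : (i, j) ∈ μ) : j < μ.rowLen i ∧ i < μ.colLen j ∧ i < N := by
    have h1 := YoungDiagram.mem_iff_lt_rowLen.1 hc
    have h2 := YoungDiagram.mem_iff_lt_colLen.1 hc
    have h3 := μ.colLen_anti 0 j (by omega)
    omega
  rw [hooks, Multiset.count_map]
  change (μ.cells.filter fun c => h = hookLength μ c).card = _
  refine card_nbij (fun c => μ.rowLen c.1 + (N - 1 - c.1)) ?_ ?_ ?_
  · rintro ⟨i, j⟩ hc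
    obtain ⟨hmem, hh'⟩ := mem_filter.1 hc
    simp only [hookLength] at hh'
    simp only [mem_coe, mem_filter, removable]
    obtain ⟨h1, h2, h3⟩ := hcell hmem
    refine ⟨mem_image.2 ⟨N - 1 - i, mem_range.2 (by omega), ?_⟩, ?_, ?_⟩
    · rw [show N - 1 - (N - 1 - i) = i by omega]
    · have := μ.colLen_anti 0 j (by omega)
      omega
    · have := μ.colLen_anti 0 j (by omega)
      rw [show μ.rowLen i + (N - 1 - i) - h = N + j - μ.colLen j by omega]
      exact colGap_notMem_betaSet hN j
  · rintro ⟨i, j⟩ hc ⟨i', j'⟩ hc' he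
    replace hc := mem_filter.1 hc
    replace hc' := mem_filter.1 hc'
    simp only [YoungDiagram.mem_cells, hookLength] at hc hc' he
    obtain ⟨h1, h2, h3⟩ := hcell hc.1
    obtain ⟨h1', h2', h3'⟩ := hcell hc'.1
    obtain rfl : i = i' := by
      by_contra hne
      rcases Nat.lt_or_gt_of_ne hne with hlt | hlt
      · have := μ.rowLen_anti i i' hlt.le
        omega
      · have := μ.rowLen_anti i' i hlt.le
        omega
    obtain rfl : j = j' := by
      by_contra hne
      rcases Nat.lt_or_gt_of_ne hne with hlt | hlt
      · have := μ.colLen_anti j j' hlt.le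
        omega
      · have := μ.colLen_anti j' j hlt.le
        omega
    rfl
  · intro x hx
    obtain ⟨hx, hhx, hy⟩ := mem_filter.1 hx
    obtain ⟨k, hk, rfl⟩ := mem_image.1 hx
    have hk := mem_range.1 hk
    obtain ⟨j, hj⟩ := exists_colGap_eq hN hy
    have h0 := μ.colLen_anti 0 j (by omega)
    have hmem : (N - 1 - k, j) ∈ μ := by
      by_contra hmem
      have h1 := mt YoungDiagram.mem_iff_lt_rowLen.2 hmem
      have h2 := mt YoungDiagram.mem_iff_lt_colLen.2 hmem
      omega
    obtain ⟨h1, h2, h3⟩ := hcell hmem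
    refine ⟨(N - 1 - k, j), ?_, ?_⟩
    · refine mem_filter.2 ⟨hmem, ?_⟩
      simp only [hookLength]
      omega
    · simp only
      omega

/-- The number of hooks of length `h` in all partitions of `n`. -/
def hookTotal (h n : ℕ) : ℕ := ∑ p : n.Partition, (hooks p).count h

theorem hookTotal_eq {N n h : ℕ} (hN : n ≤ N) (hh : 0 < h) :
    hookTotal h n = ∑ X ∈ betaSets N n, (removable h X).card := by
  rw [sum_betaSets hN, hookTotal]
  exact sum_congr rfl fun p _ => count_hooks p hN hh

theorem hookTotal_of_lt {n h : ℕ} (hn : n < h) : hookTotal h n = 0 := by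
  rw [hookTotal_eq le_rfl (by omega)]
  exact sum_eq_zero fun X hX => by rw [removable_eq_empty le_rfl hn hX, card_empty]

theorem hookTotal_add {h : ℕ} (hh : 0 < h) (n : ℕ) :
    hookTotal h (n + h) = hookTotal h n + h * Fintype.card n.Partition := by
  rw [hookTotal_eq le_rfl hh, sum_card_removable le_rfl hh,
    hookTotal_eq (Nat.le_add_right n h) hh, sum_betaSets (Nat.le_add_right n h),
    sum_betaSets (Nat.le_add_right n h), Fintype.card, ← smul_eq_mul, smul_eq_mul, mul_comm,
    ← smul_eq_mul, ← sum_const, ← sum_add_distrib]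
  refine sum_congr rfl fun p _ => card_addable (range_subset_betaSet ?_)
  have := colLen_diagram_le p
  omega

theorem pos_of_mem_hooks {n : ℕ} {p : n.Partition} {h : ℕ} (hh : h ∈ hooks p) : 0 < h := by
  obtain ⟨c, -, rfl⟩ := Multiset.mem_map.1 hh
  exact Nat.succ_pos _

theorem card_hooks {n : ℕ} (p : n.Partition) : (hooks p).card = n := by
  rw [hooks, Multiset.card_map, Finset.card_val]
  exact card_diagram p

theorem le_of_mem_hooks {n : ℕ} {p : n.Partition} {h : ℕ} (hh : h ∈ hooks p) : h ≤ n := by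
  by_contra! hn
  have h1 := hookTotal_of_lt hn
  have h2 := (sum_eq_zero_iff.1 h1) p (mem_univ _)
  exact (Multiset.count_pos.2 hh).ne' h2

theorem sum_hookTotal (n : ℕ) :
    ∑ h ∈ Icc 1 n, hookTotal h n = n * Fintype.card n.Partition := by
  simp only [hookTotal]
  rw [sum_comm, mul_comm, Fintype.card, ← smul_eq_mul, ← sum_const]
  refine sum_congr rfl fun p _ => ?_
  rw [Multiset.sum_count_eq_card, card_hooks]
  exact fun h hh => mem_Icc.2 ⟨pos_of_mem_hooks hh, le_of_mem_hooks hh⟩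

/-! ### Growth of the number of partitions -/

/-- Unrolled, the recursion reads `h ∑ p(m - jh)` over `j ≥ 1`; the bound on `p` turns this into a
geometric series of ratio `R ^ (-h)`. -/
theorem hookTotal_le {C R : ℝ} (hC : 0 ≤ C) (hR : 1 < R) {n h : ℕ} (hh : 0 < h)
    (hp : ∀ m < n, (Fintype.card m.Partition : ℝ) ≤ C * R ^ m) :
    ∀ m ≤ n, (hookTotal h m : ℝ) ≤ C * R ^ m * (h / (R ^ h - 1)) := by
  have hRh : 0 < R ^ h - 1 := sub_pos.2 (one_lt_pow₀ hR hh.ne')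
  intro m
  induction m using Nat.strong_induction_on with
  | _ m ih =>
    intro hm
    rcases lt_or_ge m h with hmh | hmh
    · rw [hookTotal_of_lt hmh, Nat.cast_zero]
      positivity
    · obtain ⟨m, rfl⟩ := Nat.exists_eq_add_of_le' hmh
      have h1 := ih m (by omega) (by omega)
      have h2 := mul_le_mul_of_nonneg_left (hp m (by omega)) (Nat.cast_nonneg (α := ℝ) h)
      rw [hookTotal_add hh]
      push_cast
      calc (hookTotal h m : ℝ) + h * Fintype.card m.Partition
          ≤ C * R ^ m * (h / (R ^ h - 1)) + h * (C * R ^ m) := add_le_add h1 h2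
        _ = C * R ^ (m + h) * (h / (R ^ h - 1)) := by
          rw [pow_add]
          field_simp
          ring

theorem summable_div_pow_sub_one {R : ℝ} (hR : 1 < R) :
    Summable fun h : ℕ => (h : ℝ) / (R ^ h - 1) := by
  have h0 : 0 < R := by linarith
  have hn : ‖R⁻¹‖ < 1 := by
    rw [norm_inv, Real.norm_of_nonneg h0.le]
    exact inv_lt_one_of_one_lt₀ hR
  have h1 := (summable_pow_mul_geometric_of_norm_lt_one (R := ℝ) 1 hn).mul_left (R / (R - 1))
  refine h1.of_nonneg_of_le (fun h => ?_) fun h => ?_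
  · exact div_nonneg (Nat.cast_nonneg _) (sub_nonneg.2 (one_le_pow₀ hR.le))
  · rcases Nat.eq_zero_or_pos h with rfl | hh
    · simp
    · have h2 : 0 < R ^ h - 1 := sub_pos.2 (one_lt_pow₀ hR hh.ne')
      have h3 : R ≤ R ^ h := le_self_pow₀ hR.le hh.ne'
      have h4 : 0 < R - 1 := by linarith
      have h5 : 0 < R ^ h := by positivity
      rw [pow_one, inv_pow, div_le_iff₀ h2]
      have : R / (R - 1) * (h * (R ^ h)⁻¹) * (R ^ h - 1) =
          h * ((R * (R ^ h - 1)) / ((R - 1) * R ^ h)) := by field_simp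
      rw [this]
      refine le_mul_of_one_le_right (Nat.cast_nonneg _) ?_
      rw [one_le_div (by positivity)]
      nlinarith

/-- The number of partitions of `n` grows subexponentially. -/
theorem exists_card_partition_le {R : ℝ} (hR : 1 < R) :
    ∃ C : ℝ, 0 ≤ C ∧ ∀ n : ℕ, (Fintype.card n.Partition : ℝ) ≤ C * R ^ n := by
  -- Summing `hookTotal_le` over `h` gives `n p(n) ≤ C R^n K`, which closes the induction once `n ≥
  -- K`; `C` is chosen to cover the finitely many smaller `n`.
  set K := ∑' h : ℕ, (h : ℝ) / (R ^ h - 1) with hK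
  set C : ℝ := ∑ j ∈ range (⌈K⌉₊ + 1), (Fintype.card j.Partition : ℝ) with hCdef
  have hC : 0 ≤ C := sum_nonneg fun _ _ => Nat.cast_nonneg _
  refine ⟨C, hC, fun n => ?_⟩
  induction n using Nat.strong_induction_on with
  | _ n ih =>
    rcases lt_or_ge n (⌈K⌉₊ + 1) with hn | hn
    · calc (Fintype.card n.Partition : ℝ) ≤ C :=
            single_le_sum (f := fun j : ℕ => (Fintype.card j.Partition : ℝ))
              (fun _ _ => Nat.cast_nonneg _) (mem_range.2 hn)
        _ ≤ C * R ^ n := le_mul_of_one_le_right hC (one_le_pow₀ hR.le)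
    · have hn0 : (0 : ℝ) < n := by exact_mod_cast (by omega : 0 < n)
      have hKn : K ≤ n := (Nat.le_ceil K).trans (by exact_mod_cast (by omega : ⌈K⌉₊ ≤ n))
      have h1 : (n : ℝ) * Fintype.card n.Partition ≤ C * R ^ n * K := by
        calc (n : ℝ) * Fintype.card n.Partition = ∑ h ∈ Icc 1 n, (hookTotal h n : ℝ) := by
              exact_mod_cast (sum_hookTotal n).symm
          _ ≤ ∑ h ∈ Icc 1 n, C * R ^ n * (h / (R ^ h - 1)) :=
              sum_le_sum fun h hh => hookTotal_le hC hR (mem_Icc.1 hh).1 ih n le_rfl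
          _ = C * R ^ n * ∑ h ∈ Icc 1 n, (h : ℝ) / (R ^ h - 1) := by rw [mul_sum]
          _ ≤ C * R ^ n * K := by
              refine mul_le_mul_of_nonneg_left ?_ (by positivity)
              exact (summable_div_pow_sub_one hR).sum_le_tsum _ fun h _ =>
                div_nonneg (Nat.cast_nonneg _) (sub_nonneg.2 (one_le_pow₀ hR.le))
      have h2 : C * R ^ n * K ≤ C * R ^ n * n :=
        mul_le_mul_of_nonneg_left hKn (by positivity)
      have h3 : (n : ℝ) * Fintype.card n.Partition ≤ n * (C * R ^ n) := by linarith
      exact le_of_mul_le_mul_left h3 hn0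

theorem summable_pow_mul_card_partition (d : ℕ) {r : ℝ} (hr0 : 0 ≤ r) (hr : r < 1) :
    Summable fun n : ℕ => (Fintype.card n.Partition : ℝ) * ((n : ℝ) ^ d * r ^ n) := by
  -- This growth rate exceeds 1, while its product with `r` stays below 1.
  have hR : 1 < 2 / (1 + r) := by rw [lt_div_iff₀ (by linarith)]; linarith
  obtain ⟨C, hC, h⟩ := exists_card_partition_le hR
  have hn : ‖2 / (1 + r) * r‖ < 1 := by
    rw [Real.norm_of_nonneg (by positivity), div_mul_eq_mul_div, div_lt_one (by linarith)]
    linarith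
  have hs := (summable_pow_mul_geometric_of_norm_lt_one (R := ℝ) d hn).mul_left C
  refine hs.of_nonneg_of_le (fun n => by positivity) fun n => ?_
  calc (Fintype.card n.Partition : ℝ) * ((n : ℝ) ^ d * r ^ n)
      ≤ C * (2 / (1 + r)) ^ n * ((n : ℝ) ^ d * r ^ n) :=
        mul_le_mul_of_nonneg_right (h n) (by positivity)
    _ = C * ((n : ℝ) ^ d * (2 / (1 + r) * r) ^ n) := by rw [mul_pow]; ring

theorem summable_allPartitions (d : ℕ) {r : ℝ} (hr0 : 0 ≤ r) (hr : r < 1) :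
    Summable fun p : AllPartitions => (p.1 : ℝ) ^ d * r ^ p.1 := by
  refine (summable_sigma_of_nonneg fun p => by positivity).2 ⟨fun n => Summable.of_finite, ?_⟩
  refine (summable_pow_mul_card_partition d hr0 hr).congr fun n => ?_
  simp [tsum_fintype, Finset.card_univ]

theorem summable_allPartitions_pow {q : ℂ} (hq : ‖q‖ < 1) :
    Summable fun p : AllPartitions => q ^ p.1 := by
  refine Summable.of_norm_bounded (summable_allPartitions 0 (norm_nonneg q) hq) fun p => ?_
  simp

theorem tsum_allPartitions {f : AllPartitions → ℂ} (hf : Summable f) :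
    ∑' p, f p = ∑' n : ℕ, ∑ p : n.Partition, f ⟨n, p⟩ := by
  rw [hf.tsum_sigma]
  simp only [tsum_fintype]

/-! ### The generating function of partitions does not vanish -/

/-- The number of partitions of `n` into parts larger than `N`. -/
def largePartCount (N n : ℕ) : ℕ := (univ.filter fun p : n.Partition => ∀ i ∈ p.parts, N < i).card

theorem largePartCount_le (N n : ℕ) : largePartCount N n ≤ Fintype.card n.Partition :=
  card_le_univ _

theorem largePartCount_zero_left (n : ℕ) : largePartCount 0 n = Fintype.card n.Partition := by
  rw [largePartCount, filter_true_of_mem, card_univ]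
  exact fun p _ i hi => p.parts_pos hi

theorem largePartCount_zero_right (N : ℕ) : largePartCount N 0 = 1 := by
  rw [largePartCount, filter_true_of_mem, card_univ]
  · exact Fintype.card_unique
  · intro p _ i hi
    simp [Subsingleton.elim p default] at hi

theorem largePartCount_eq_zero {N n : ℕ} (hn : n ≠ 0) (hnN : n ≤ N) : largePartCount N n = 0 := by
  rw [largePartCount, card_eq_zero, filter_eq_empty_iff]
  intro p _ h
  have h0 : p.parts ≠ 0 := fun h0 => hn (by rw [← p.parts_sum, h0, Multiset.sum_zero])
  obtain ⟨i, hi⟩ := Multiset.exists_mem_of_ne_zero h0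
  have := Multiset.le_sum_of_mem hi
  rw [p.parts_sum] at this
  have := h i hi
  omega

theorem largePartCount_succ_eq (N n : ℕ) :
    largePartCount N n = largePartCount (N + 1) n +
      (univ.filter fun p : n.Partition => (∀ i ∈ p.parts, N < i) ∧ N + 1 ∈ p.parts).card := by
  rw [largePartCount, ← card_filter_add_card_filter_not (fun p => N + 1 ∈ p.parts),
    filter_filter, filter_filter, add_comm, largePartCount]
  congr 2
  refine filter_congr fun p _ => ⟨fun h i hi => ?_, fun h => ⟨fun i hi => ?_, fun hi => ?_⟩⟩
  · have h1 := h.1 i hi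
    have h2 : i ≠ N + 1 := fun e => h.2 (e ▸ hi)
    omega
  · have := h i hi
    omega
  · exact lt_irrefl _ (h _ hi)

theorem largePartCount_of_lt {N n : ℕ} (h : n < N + 1) :
    largePartCount N n = largePartCount (N + 1) n := by
  rw [largePartCount_succ_eq, Nat.add_eq_left, card_eq_zero, filter_eq_empty_iff]
  rintro p _ ⟨-, hp⟩
  have := Multiset.le_sum_of_mem hp
  rw [p.parts_sum] at this
  omega

/-- Partitions that contain the part `N + 1` correspond to smaller ones by deleting one copy of it.
-/
theorem largePartCount_add (N n : ℕ) :
    largePartCount N (n + (N + 1)) = largePartCount (N + 1) (n + (N + 1)) + largePartCount N n := by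
  rw [largePartCount_succ_eq, Nat.add_left_cancel_iff, largePartCount]
  symm
  refine card_bij (fun p _ => ⟨(N + 1) ::ₘ p.parts, ?_, ?_⟩) ?_ ?_ ?_
  · intro i hi
    rcases Multiset.mem_cons.1 hi with rfl | hi
    · omega
    · exact p.parts_pos hi
  · rw [Multiset.sum_cons, p.parts_sum, add_comm]
  · intro p hp
    have hp := (mem_filter.1 hp).2
    refine mem_filter.2 ⟨mem_univ _, fun i hi => ?_, Multiset.mem_cons_self _ _⟩
    rcases Multiset.mem_cons.1 hi with rfl | hi
    · omega
    · exact hp i hi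
  · intro p _ p' _ h
    have := congrArg Nat.Partition.parts h
    exact Nat.Partition.ext (by simpa using this)
  · intro p hp
    obtain ⟨h1, h2⟩ := (mem_filter.1 hp).2
    refine ⟨⟨p.parts.erase (N + 1), fun h => p.parts_pos (Multiset.mem_of_mem_erase h), ?_⟩,
      mem_filter.2 ⟨mem_univ _, fun i hi => h1 i (Multiset.mem_of_mem_erase hi)⟩,
      Nat.Partition.ext (Multiset.cons_erase h2)⟩
    have h3 := congrArg Multiset.sum (Multiset.cons_erase h2)
    rw [Multiset.sum_cons, p.parts_sum] at h3
    omega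

theorem norm_largePartCount_mul_pow_le (N n : ℕ) (q : ℂ) :
    ‖(largePartCount N n : ℂ) * q ^ n‖ ≤
      (Fintype.card n.Partition : ℝ) * ((n : ℝ) ^ 0 * ‖q‖ ^ n) := by
  rw [norm_mul, Complex.norm_natCast, norm_pow, pow_zero, one_mul]
  exact mul_le_mul_of_nonneg_right (by exact_mod_cast largePartCount_le N n) (by positivity)

theorem summable_largePartCount (N : ℕ) {q : ℂ} (hq : ‖q‖ < 1) :
    Summable fun n : ℕ => (largePartCount N n : ℂ) * q ^ n :=
  Summable.of_norm_bounded (summable_pow_mul_card_partition 0 (norm_nonneg q) hq)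
    fun n => norm_largePartCount_mul_pow_le N n q

theorem tsum_largePartCount_succ (N : ℕ) {q : ℂ} (hq : ‖q‖ < 1) :
    ∑' n : ℕ, (largePartCount (N + 1) n : ℂ) * q ^ n =
      (1 - q ^ (N + 1)) * ∑' n : ℕ, (largePartCount N n : ℂ) * q ^ n := by
  have hs := summable_largePartCount N hq
  have hs' := summable_largePartCount (N + 1) hq
  have h1 := hs.sum_add_tsum_nat_add (N + 1)
  rw [sub_mul, one_mul, eq_sub_iff_add_eq, ← h1, ← hs'.sum_add_tsum_nat_add (N + 1), add_assoc]
  congr 1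
  · exact sum_congr rfl fun n hn => by rw [largePartCount_of_lt (mem_range.1 hn)]
  · rw [h1, ← tsum_mul_left, ← ((summable_nat_add_iff (N + 1)).2 hs').tsum_add (hs.mul_left _)]
    refine tsum_congr fun n => ?_
    rw [largePartCount_add]
    push_cast
    ring

theorem tsum_allPartitions_pow {q : ℂ} (hq : ‖q‖ < 1) :
    ∑' p : AllPartitions, q ^ p.1 = ∑' n : ℕ, (Fintype.card n.Partition : ℂ) * q ^ n := by
  rw [tsum_allPartitions (summable_allPartitions_pow hq)]
  simp [Finset.card_univ]

/-- Dividing out Euler factors one at a time would keep the series zero for every `N`, yet by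
dominated convergence these series tend to their constant term 1. -/
theorem tsum_allPartitions_pow_ne_zero {q : ℂ} (hq : ‖q‖ < 1) :
    ∑' p : AllPartitions, q ^ p.1 ≠ 0 := by
  intro h0
  rw [tsum_allPartitions_pow hq] at h0
  have h1 (N : ℕ) : ∑' n : ℕ, (largePartCount N n : ℂ) * q ^ n = 0 := by
    induction N with
    | zero => simpa only [largePartCount_zero_left] using h0
    | succ N ih => rw [tsum_largePartCount_succ N hq, ih, mul_zero]
  have h2 : Tendsto (fun N : ℕ => ∑' n : ℕ, (largePartCount N n : ℂ) * q ^ n) atTop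
      (𝓝 (∑' n : ℕ, if n = 0 then (1 : ℂ) else 0)) := by
    refine tendsto_tsum_of_dominated_convergence
      (summable_pow_mul_card_partition 0 (norm_nonneg q) hq) (fun n => ?_)
      (Eventually.of_forall fun N n => norm_largePartCount_mul_pow_le N n q)
    refine tendsto_const_nhds.congr' ?_
    filter_upwards [eventually_ge_atTop n] with N hN
    split_ifs with hn
    · simp [hn, largePartCount_zero_right]
    · simp [largePartCount_eq_zero hn hN]
  simp only [h1, tsum_ite_eq] at h2
  exact zero_ne_one (tendsto_nhds_unique tendsto_const_nhds h2)

/-! ### The generating function of the hooks of a given length -/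

theorem norm_count_mul_pow_le (h : ℕ) (q : ℂ) (p : AllPartitions) :
    ‖((hooks p.2).count h : ℂ) * q ^ p.1‖ ≤ (p.1 : ℝ) ^ 1 * ‖q‖ ^ p.1 := by
  rw [norm_mul, Complex.norm_natCast, norm_pow, pow_one]
  refine mul_le_mul_of_nonneg_right ?_ (by positivity)
  exact_mod_cast (Multiset.count_le_card _ _).trans (card_hooks p.2).le

theorem summable_count_mul_pow (h : ℕ) {q : ℂ} (hq : ‖q‖ < 1) :
    Summable fun p : AllPartitions => ((hooks p.2).count h : ℂ) * q ^ p.1 :=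
  Summable.of_norm_bounded (summable_allPartitions 1 (norm_nonneg q) hq)
    fun p => norm_count_mul_pow_le h q p

theorem one_sub_pow_ne_zero {q : ℂ} (hq : ‖q‖ < 1) {h : ℕ} (hh : h ≠ 0) : 1 - q ^ h ≠ 0 := by
  intro h0
  have h1 := pow_lt_one₀ (norm_nonneg q) hq hh
  rw [← norm_pow, ← sub_eq_zero.1 h0, norm_one] at h1
  exact lt_irrefl _ h1

theorem tsum_count_mul_pow (h : ℕ) {q : ℂ} (hq : ‖q‖ < 1) :
    ∑' p : AllPartitions, ((hooks p.2).count h : ℂ) * q ^ p.1 =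
      h * (q ^ h / (1 - q ^ h)) * ∑' p : AllPartitions, q ^ p.1 := by
  rcases Nat.eq_zero_or_pos h with rfl | hh
  · have (p : AllPartitions) : (hooks p.2).count 0 = 0 :=
      Multiset.count_eq_zero.2 fun h0 => lt_irrefl _ (pos_of_mem_hooks h0)
    simp [this]
  have hP : Summable fun n : ℕ => (Fintype.card n.Partition : ℂ) * q ^ n := by
    simpa only [largePartCount_zero_left] using summable_largePartCount 0 hq
  have e1 : ∀ n : ℕ, ∑ p : n.Partition, ((hooks p).count h : ℂ) * q ^ n =
      (hookTotal h n : ℂ) * q ^ n := fun n => by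
    rw [← sum_mul, hookTotal, Nat.cast_sum]
  have hs : Summable fun n : ℕ => (hookTotal h n : ℂ) * q ^ n := by
    refine (summable_count_mul_pow h hq).sigma.congr fun n => ?_
    rw [tsum_fintype]
    exact e1 n
  rw [tsum_allPartitions (summable_count_mul_pow h hq), tsum_allPartitions_pow hq]
  simp only [e1]
  have h1 := hs.sum_add_tsum_nat_add h
  rw [sum_eq_zero fun n hn => by rw [hookTotal_of_lt (mem_range.1 hn), Nat.cast_zero, zero_mul],
    zero_add] at h1
  -- With `H` and `P` the generating functions of `h`-hooks and of partitions, the recursion says `H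
  -- = q^h (H + h P)`; it remains to solve for `H`.
  have h2 : ∑' n : ℕ, (hookTotal h (n + h) : ℂ) * q ^ (n + h) =
      q ^ h * (∑' n : ℕ, (hookTotal h n : ℂ) * q ^ n +
        h * ∑' n : ℕ, (Fintype.card n.Partition : ℂ) * q ^ n) := by
    rw [← tsum_mul_left, ← hs.tsum_add (hP.mul_left _), ← tsum_mul_left]
    refine tsum_congr fun n => ?_
    rw [hookTotal_add hh]
    push_cast
    ring
  rw [h1] at h2
  have h3 := one_sub_pow_ne_zero hq hh.ne'
  field_simp
  linear_combination h2

/-! ### The bracket of a weighted hook sum -/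

theorem summable_lambert {r : ℝ} (hr0 : 0 ≤ r) (hr : r < 1) :
    Summable fun h : ℕ => (h : ℝ) * (r ^ h / (1 - r ^ h)) := by
  rcases hr0.eq_or_lt with rfl | hr0
  · refine summable_of_ne_finset_zero (s := ∅) fun h _ => ?_
    rcases Nat.eq_zero_or_pos h with rfl | hh
    · simp
    · simp [hh.ne']
  · refine (summable_div_pow_sub_one ((one_lt_inv₀ hr0).2 hr)).congr fun h => ?_
    have : r ^ h ≠ 0 := by positivity
    rw [inv_pow, div_eq_mul_inv, show (r ^ h)⁻¹ - 1 = (1 - r ^ h) / r ^ h by field_simp, inv_div]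

theorem tsum_count_mul_pow_real (h : ℕ) {r : ℝ} (hr0 : 0 ≤ r) (hr : r < 1) :
    ∑' p : AllPartitions, ((hooks p.2).count h : ℝ) * r ^ p.1 =
      h * (r ^ h / (1 - r ^ h)) * ∑' p : AllPartitions, r ^ p.1 := by
  have := tsum_count_mul_pow h (q := r) (by rwa [Complex.norm_real, Real.norm_of_nonneg hr0])
  exact_mod_cast this

/-- After taking norms, the inner sum over partitions is known exactly, so summability reduces to
that of a real Lambert series. -/
theorem summable_hook_pairs {c : ℕ → ℂ} {B : ℝ} (hc : ∀ h, ‖c h‖ ≤ B) {q : ℂ} (hq : ‖q‖ < 1) :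
    Summable fun a : ℕ × AllPartitions => c a.1 * (((hooks a.2.2).count a.1 : ℂ) * q ^ a.2.1) := by
  have hB : 0 ≤ B := (norm_nonneg _).trans (hc 0)
  have hb : Summable fun a : ℕ × AllPartitions =>
      B * (((hooks a.2.2).count a.1 : ℝ) * ‖q‖ ^ a.2.1) := by
    refine Summable.mul_left _ ((summable_prod_of_nonneg fun a => by positivity).2 ⟨fun h => ?_, ?_⟩)
    · refine (summable_allPartitions 1 (norm_nonneg q) hq).of_nonneg_of_le
        (fun p => by positivity) fun p => ?_
      simpa using norm_count_mul_pow_le h q p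
    · simp only [tsum_count_mul_pow_real _ (norm_nonneg q) hq]
      exact (summable_lambert (norm_nonneg q) hq).mul_right _
  refine Summable.of_norm_bounded hb fun a => ?_
  rw [norm_mul, norm_mul, Complex.norm_natCast, norm_pow]
  exact mul_le_mul_of_nonneg_right (hc _) (by positivity)

theorem hasSum_hooks (c : ℕ → ℂ) (p : AllPartitions) :
    HasSum (fun h : ℕ => c h * ((hooks p.2).count h : ℂ)) ((hooks p.2).map c).sum := by
  rw [Finset.sum_multiset_map_count]
  simp only [nsmul_eq_mul, mul_comm _ (c _)]
  refine hasSum_sum_of_ne_finset_zero fun h hh => ?_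
  rw [Multiset.count_eq_zero.2 fun h' => hh (Multiset.mem_toFinset.2 h'), Nat.cast_zero, mul_zero]

/-- The absolutely convergent double sum over hook lengths and partitions is evaluated in both
orders. -/
theorem hasSum_hook_weights {c : ℕ → ℂ} {B : ℝ} (hc : ∀ h, ‖c h‖ ≤ B) {q : ℂ} (hq : ‖q‖ < 1) :
    HasSum (fun p : AllPartitions => ((hooks p.2).map c).sum * q ^ p.1)
      ((∑' h : ℕ, c h * (h * (q ^ h / (1 - q ^ h)))) * ∑' p : AllPartitions, q ^ p.1) := by
  have hs := summable_hook_pairs hc hq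
  have h1 := hs.hasSum.prod_fiberwise fun h => ((summable_count_mul_pow h hq).mul_left _).hasSum
  have h2 := ((Equiv.prodComm AllPartitions ℕ).hasSum_iff.2 hs.hasSum).prod_fiberwise fun p => by
    have := (hasSum_hooks c p).mul_right (q ^ p.1)
    simp only [mul_assoc] at this
    exact this
  convert h2 using 1
  rw [← h1.tsum_eq, ← tsum_mul_right]
  refine tsum_congr fun h => ?_
  rw [tsum_mul_left, tsum_count_mul_pow h hq]
  ring

/-! ### Lambert series and the cotangent -/

/-- The Lambert series `∑ n^(-2k-1) q^n / (1 - q^n)`. -/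
noncomputable def lambert (k : ℕ) (q : ℂ) : ℂ :=
  ∑' n : ℕ, 1 / (n : ℂ) ^ (2 * k + 1) * (q ^ n / (1 - q ^ n))

theorem norm_nome (z : ℂ) : ‖nome z‖ = Real.exp (-(2 * Real.pi * z.im)) := by
  rw [nome, Complex.norm_exp]
  congr 1
  simp

theorem norm_nome_lt_one {z : ℂ} (hz : 0 < z.im) : ‖nome z‖ < 1 := by
  rw [norm_nome, Real.exp_lt_one_iff]
  have := Real.pi_pos
  simp only [Left.neg_neg_iff]
  positivity

theorem nome_natCast_mul (n : ℕ) (z : ℂ) : nome (n * z) = nome z ^ n := by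
  rw [nome, nome, ← Complex.exp_nat_mul]
  ring_nf

theorem nome_add_one (z : ℂ) : nome (z + 1) = nome z := by
  rw [nome, nome, mul_add, mul_one, Complex.exp_add, Complex.exp_two_pi_mul_I, mul_one]

theorem norm_one_div_natCast_pow_le_one (n d : ℕ) : ‖(1 : ℂ) / (n : ℂ) ^ d‖ ≤ 1 := by
  rw [norm_div, norm_one, norm_pow, Complex.norm_natCast]
  rcases Nat.eq_zero_or_pos n with rfl | hn
  · rcases Nat.eq_zero_or_pos d with rfl | hd
    · simp
    · simp [hd.ne']
  · exact div_le_one_of_le₀ (one_le_pow₀ (by exact_mod_cast hn)) (by positivity)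

theorem summable_lambert_terms (k : ℕ) {q : ℂ} (hq : ‖q‖ < 1) :
    Summable fun n : ℕ => 1 / (n : ℂ) ^ (2 * k + 1) * (q ^ n / (1 - q ^ n)) := by
  refine Summable.of_norm_bounded (summable_lambert (norm_nonneg q) hq) fun n => ?_
  rcases Nat.eq_zero_or_pos n with rfl | hn
  · simp
  have h1 : 0 < 1 - ‖q‖ ^ n := sub_pos.2 (pow_lt_one₀ (norm_nonneg q) hq hn.ne')
  rw [norm_mul]
  refine mul_le_mul ((norm_one_div_natCast_pow_le_one _ _).trans (by exact_mod_cast hn)) ?_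
    (norm_nonneg _) (Nat.cast_nonneg _)
  rw [norm_div, norm_pow]
  refine div_le_div_of_nonneg_left (by positivity) h1 ?_
  have := norm_sub_norm_le (1 : ℂ) (q ^ n)
  rwa [norm_one, norm_pow] at this

theorem tsum_pnat_eq_tsum_nat {f : ℕ → ℂ} (h0 : f 0 = 0) : ∑' n : ℕ+, f n = ∑' n : ℕ, f n := by
  refine PNat.coe_injective.tsum_eq fun n hn => ?_
  exact ⟨⟨n, Nat.pos_of_ne_zero fun h => hn (h ▸ h0)⟩, rfl⟩

theorem summable_one_div_pnat_pow {s : ℕ} (hs : 1 < s) :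
    Summable fun n : ℕ+ => 1 / (n : ℂ) ^ s := by
  have h : Summable fun n : ℕ => 1 / (n : ℂ) ^ s := by
    refine Summable.of_norm ((Real.summable_one_div_nat_pow.2 hs).congr fun n => ?_)
    simp
  exact h.comp_injective PNat.coe_injective

theorem tsum_one_div_pnat_pow {s : ℕ} (hs : 1 < s) :
    ∑' n : ℕ+, 1 / (n : ℂ) ^ s = riemannZeta s := by
  rw [zeta_nat_eq_tsum_of_gt_one hs]
  exact tsum_pnat_eq_tsum_nat (f := fun n => 1 / (n : ℂ) ^ s) (by simp [show s ≠ 0 by omega])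

/-- The series `∑ n^(-2k-1) π cot (π n z)`. -/
noncomputable def cotSeries (k : ℕ) (z : ℂ) : ℂ :=
  ∑' n : ℕ+, 1 / (n : ℂ) ^ (2 * k + 1) * (Real.pi * Complex.cot (Real.pi * (n * z)))

/-- Termwise, `π cot(πw) = -πi (1 + 2e / (1 - e))` with `e = exp(2πiw)`; the constant 1 contributes
the zeta value. -/
theorem cotSeries_eq_lambert {k : ℕ} (hk : 1 ≤ k) {z : ℂ} (hz : 0 < z.im) :
    cotSeries k z = -(Real.pi * Complex.I) *
      (riemannZeta (2 * k + 1 : ℕ) + 2 * lambert k (nome z)) := by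
  have hq := norm_nome_lt_one hz
  have h1 : lambert k (nome z) =
      ∑' n : ℕ+, 1 / (n : ℂ) ^ (2 * k + 1) * (nome z ^ (n : ℕ) / (1 - nome z ^ (n : ℕ))) :=
    (tsum_pnat_eq_tsum_nat
      (f := fun n => 1 / (n : ℂ) ^ (2 * k + 1) * (nome z ^ n / (1 - nome z ^ n))) (by simp)).symm
  have hs : Summable fun n : ℕ+ =>
      1 / (n : ℂ) ^ (2 * k + 1) * (nome z ^ (n : ℕ) / (1 - nome z ^ (n : ℕ))) :=
    (summable_lambert_terms k hq).comp_injective PNat.coe_injective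
  rw [h1, ← tsum_one_div_pnat_pow (by omega), ← tsum_mul_left,
    ← (summable_one_div_pnat_pow (by omega)).tsum_add (hs.mul_left 2), ← tsum_mul_left, cotSeries]
  refine tsum_congr fun n => ?_
  have h2 := one_sub_pow_ne_zero hq n.ne_zero
  have h3 : Complex.cot (Real.pi * (n * z)) =
      (nome z ^ (n : ℕ) + 1) / (Complex.I * (1 - nome z ^ (n : ℕ))) := by
    rw [Complex.cot_pi_eq_exp_ratio, ← nome_natCast_mul, nome]
  have hn : (n : ℂ) ≠ 0 := by exact_mod_cast n.ne_zero
  rw [h3]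
  field_simp
  linear_combination (1 + nome z ^ (n : ℕ)) * Complex.I_sq

/-! ### The double series -/

/-- The terms `n^(-2k) / (n²z² - m²)` of the partial fraction expansion of `cotSeries k z`. -/
noncomputable def cotTerm (k : ℕ) (z : ℂ) (a : ℕ+ × ℕ+) : ℂ :=
  1 / (a.1 : ℂ) ^ (2 * k) * (1 / ((a.1 : ℂ) ^ 2 * z ^ 2 - (a.2 : ℂ) ^ 2))

/-- Multiplying by the conjugate of `z` makes the `s` term real, so the imaginary part sees only
`t`; the bound is uniform in `s`. -/
theorem mul_im_le_norm_add (z : ℂ) (hz : 0 < z.im) (s t : ℝ) :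
    |t| * z.im ≤ ‖(s : ℂ) * z + t‖ * ‖z‖ := by
  have h1 : (((s : ℂ) * z + t) * (starRingEnd ℂ) z).im = -(t * z.im) := by
    simp
    ring
  calc |t| * z.im = |(((s : ℂ) * z + t) * (starRingEnd ℂ) z).im| := by
        rw [h1, abs_neg, abs_mul, abs_of_pos hz]
    _ ≤ ‖((s : ℂ) * z + t) * (starRingEnd ℂ) z‖ := Complex.abs_im_le_norm _
    _ = ‖(s : ℂ) * z + t‖ * ‖z‖ := by rw [norm_mul, RCLike.norm_conj]

theorem sq_mul_le_norm_sub {z : ℂ} (hz : 0 < z.im) (n m : ℕ+) :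
    ((m : ℝ) * z.im) ^ 2 ≤ ‖(n : ℂ) ^ 2 * z ^ 2 - (m : ℂ) ^ 2‖ * ‖z‖ ^ 2 := by
  have h1 := mul_im_le_norm_add z hz n m
  have h2 := mul_im_le_norm_add z hz n (-m)
  rw [abs_neg] at h2
  rw [abs_of_nonneg (by positivity)] at h1 h2
  have e : (n : ℂ) ^ 2 * z ^ 2 - (m : ℂ) ^ 2 = (n * z + m) * (n * z + -m) := by ring
  have h3 := mul_le_mul h1 h2 (by positivity) (by positivity)
  push_cast at h3
  rw [e, norm_mul]
  calc _ = (m : ℝ) * z.im * (m * z.im) := by ring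
    _ ≤ _ := h3
    _ = _ := by ring

theorem sq_mul_sq_sub_ne_zero {z : ℂ} (hz : 0 < z.im) (n m : ℕ+) :
    (n : ℂ) ^ 2 * z ^ 2 - (m : ℂ) ^ 2 ≠ 0 := by
  intro h
  have h1 := sq_mul_le_norm_sub hz n m
  rw [h, norm_zero, zero_mul] at h1
  have : (0 : ℝ) < m := by exact_mod_cast m.pos
  have : 0 < ((m : ℝ) * z.im) ^ 2 := by positivity
  linarith

theorem summable_cotTerm {k : ℕ} (hk : 1 ≤ k) {z : ℂ} (hz : 0 < z.im) :
    Summable (cotTerm k z) := by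
  -- The denominators give decay `m^(-2)` uniformly in `n`; decay in `n` comes from the weight
  -- `n^(-2k)`, which needs `k ≥ 1`.
  have hs := ((summable_one_div_pnat_pow (show 1 < 2 * k by omega)).norm.mul_of_nonneg
    (summable_one_div_pnat_pow (show 1 < 2 by omega)).norm (fun _ => norm_nonneg _)
    fun _ => norm_nonneg _).mul_left ((‖z‖ / z.im) ^ 2)
  refine Summable.of_norm_bounded hs fun ⟨n, m⟩ => ?_
  have h1 := sq_mul_le_norm_sub hz n m
  have h2 : 0 < ‖(n : ℂ) ^ 2 * z ^ 2 - (m : ℂ) ^ 2‖ :=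
    norm_pos_iff.2 (sq_mul_sq_sub_ne_zero hz n m)
  have hm : (0 : ℝ) < m := by exact_mod_cast m.pos
  rw [cotTerm, norm_mul, mul_left_comm]
  refine mul_le_mul_of_nonneg_left ?_ (norm_nonneg _)
  rw [norm_div, norm_one, norm_div, norm_one, norm_pow, Complex.norm_natCast, div_pow,
    div_mul_div_comm, mul_one, div_le_div_iff₀ h2 (by positivity), one_mul]
  linarith

theorem cot_eq_inv_add_tsum {z : ℂ} (hz : 0 < z.im) (n : ℕ+) :
    Real.pi * Complex.cot (Real.pi * (n * z)) =
      1 / (n * z) + 2 * (n * z) * ∑' m : ℕ+, 1 / ((n : ℂ) ^ 2 * z ^ 2 - (m : ℂ) ^ 2) := by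
  have hn : (0 : ℝ) < n := by exact_mod_cast n.pos
  have him : 0 < ((n : ℂ) * z).im := by simpa using mul_pos hn hz
  rw [cot_series_rep (UpperHalfPlane.coe_mem_integerComplement ⟨n * z, him⟩), ← tsum_mul_left]
  congr 1
  refine tsum_congr fun m => ?_
  have h0 := sq_mul_sq_sub_ne_zero hz n m
  have e : (n : ℂ) ^ 2 * z ^ 2 - (m : ℂ) ^ 2 = (n * z - m) * (n * z + m) := by ring
  rw [e] at h0 ⊢
  have h1 := left_ne_zero_of_mul h0
  have h2 := right_ne_zero_of_mul h0
  field_simp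
  ring

theorem cotSeries_eq_tsum {k : ℕ} (hk : 1 ≤ k) {z : ℂ} (hz : 0 < z.im) :
    cotSeries k z = riemannZeta (2 * k + 2 : ℕ) / z + 2 * z * ∑' a, cotTerm k z a := by
  have hs := summable_cotTerm hk hz
  have hz0 : z ≠ 0 := fun h => by simp [h] at hz
  rw [hs.tsum_prod, ← tsum_one_div_pnat_pow (by omega), div_eq_mul_inv, ← tsum_mul_right,
    ← tsum_mul_left, ← ((summable_one_div_pnat_pow (by omega)).mul_right _).tsum_add
      (hs.prod.mul_left _), cotSeries]
  refine tsum_congr fun n => ?_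
  have hn : (n : ℂ) ≠ 0 := by exact_mod_cast n.ne_zero
  simp only [cotTerm]
  rw [tsum_mul_left, cot_eq_inv_add_tsum hz]
  field_simp
  ring

theorem neg_one_div_im_pos {z : ℂ} (hz : 0 < z.im) : 0 < (-1 / z).im := by
  have hz0 : z ≠ 0 := fun h => by simp [h] at hz
  rw [neg_div, one_div, Complex.neg_im, Complex.inv_im, neg_div, neg_neg]
  exact div_pos hz (Complex.normSq_pos.2 hz0)

/-- Both terms have denominator `n²z² - m²` up to a factor, and their combined numerator is a
multiple of `m^(2k) - (nz)^(2k)`, which that denominator divides. Only a finite geometric sum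
remains. -/
theorem cotTerm_add_cotTerm (k : ℕ) {z : ℂ} (hz : 0 < z.im) (a : ℕ+ × ℕ+) :
    2 * z * cotTerm k z a - z ^ (2 * k) * (2 * (-1 / z)) * cotTerm k (-1 / z) a.swap =
      -2 * ∑ j ∈ range k, z ^ (2 * j + 1) *
        (1 / (a.1 : ℂ) ^ (2 * (k - j)) * (1 / (a.2 : ℂ) ^ (2 * (j + 1)))) := by
  obtain ⟨n, m⟩ := a
  have hz0 : z ≠ 0 := fun h => by simp [h] at hz
  have hn : (n : ℂ) ≠ 0 := by exact_mod_cast n.ne_zero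
  have hm : (m : ℂ) ≠ 0 := by exact_mod_cast m.ne_zero
  have h0 := sq_mul_sq_sub_ne_zero hz n m
  have hg := (Commute.all ((n : ℂ) ^ 2 * z ^ 2) ((m : ℂ) ^ 2)).geom_sum₂_mul k
  have h1 : ∑ j ∈ range k, z ^ (2 * j + 1) *
        (1 / (n : ℂ) ^ (2 * (k - j)) * (1 / (m : ℂ) ^ (2 * (j + 1)))) =
      z / ((n : ℂ) ^ (2 * k) * (m : ℂ) ^ (2 * k)) *
        ∑ j ∈ range k, ((n : ℂ) ^ 2 * z ^ 2) ^ j * ((m : ℂ) ^ 2) ^ (k - 1 - j) := by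
    rw [mul_sum]
    refine sum_congr rfl fun j hj => ?_
    have hj := mem_range.1 hj
    obtain ⟨d, rfl⟩ := Nat.exists_eq_add_of_lt hj
    rw [show j + d + 1 - j = d + 1 by omega, show j + d + 1 - 1 - j = d by omega]
    field_simp
    ring
  have h2 : ((m : ℂ) ^ 2 * (-1 / z) ^ 2 - (n : ℂ) ^ 2) =
      -((n : ℂ) ^ 2 * z ^ 2 - (m : ℂ) ^ 2) / z ^ 2 := by
    field_simp
    ring
  rw [h1, eq_div_of_mul_eq h0 hg]
  simp only [cotTerm, Prod.swap]
  rw [h2]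
  field_simp
  ring

theorem hasSum_one_div_mul_one_div {r s : ℕ} (hr : 1 < r) (hs : 1 < s) :
    HasSum (fun a : ℕ+ × ℕ+ => 1 / (a.1 : ℂ) ^ r * (1 / (a.2 : ℂ) ^ s))
      (riemannZeta r * riemannZeta s) := by
  have h1 := (summable_one_div_pnat_pow hr).norm
  have h2 := (summable_one_div_pnat_pow hs).norm
  rw [← tsum_one_div_pnat_pow hr, ← tsum_one_div_pnat_pow hs,
    tsum_mul_tsum_of_summable_norm h1 h2]
  exact (summable_mul_of_summable_norm h1 h2).hasSum

/-- The finite sum `∑ ζ(2m) ζ(2k+2-2m) z^(2m-1)` over `0 ≤ m ≤ k + 1`. -/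
noncomputable def zetaSum (k : ℕ) (z : ℂ) : ℂ :=
  ∑ m ∈ range (k + 2), riemannZeta (2 * m : ℕ) * riemannZeta (2 * (k + 1 - m) : ℕ) *
    z ^ (2 * (m : ℤ) - 1)

/-- The two end terms involve `ζ(0) = -1/2`; they match the `1/z` terms split off from the cotangent
expansions. -/
theorem zetaSum_eq (k : ℕ) (z : ℂ) :
    zetaSum k z = -(1 / 2) * riemannZeta (2 * k + 2 : ℕ) * (1 / z + z ^ (2 * k + 1)) +
      ∑ j ∈ range k, z ^ (2 * j + 1) *
        (riemannZeta (2 * (k - j) : ℕ) * riemannZeta (2 * (j + 1) : ℕ)) := by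
  rw [zetaSum, sum_range_succ, sum_range_succ']
  have h0 : riemannZeta (0 : ℕ) = -1 / 2 := by rw [Nat.cast_zero, riemannZeta_zero]
  have h1 : ∑ j ∈ range k, riemannZeta (2 * (j + 1) : ℕ) *
      riemannZeta (2 * (k + 1 - (j + 1)) : ℕ) * z ^ (2 * ((j + 1 : ℕ) : ℤ) - 1) =
      ∑ j ∈ range k, z ^ (2 * j + 1) *
        (riemannZeta (2 * (k - j) : ℕ) * riemannZeta (2 * (j + 1) : ℕ)) := by
    refine sum_congr rfl fun j _ => ?_
    rw [show 2 * ((j + 1 : ℕ) : ℤ) - 1 = ((2 * j + 1 : ℕ) : ℤ) by push_cast; ring, zpow_natCast,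
      Nat.add_sub_add_right]
    ring
  rw [h1, Nat.sub_self, Nat.sub_zero, mul_zero, h0,
    show 2 * ((k + 1 : ℕ) : ℤ) - 1 = ((2 * k + 1 : ℕ) : ℤ) by push_cast; ring, zpow_natCast,
    show 2 * ((0 : ℕ) : ℤ) - 1 = -1 by simp, zpow_neg_one, show 2 * (k + 1) = 2 * k + 2 by ring]
  ring

theorem cotSeries_sub {k : ℕ} (hk : 1 ≤ k) {z : ℂ} (hz : 0 < z.im) :
    cotSeries k z - z ^ (2 * k) * cotSeries k (-1 / z) = -2 * zetaSum k z := by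
  have hz0 : z ≠ 0 := fun h => by simp [h] at hz
  have hz' := neg_one_div_im_pos hz
  have h1 := (summable_cotTerm hk hz).hasSum.mul_left (2 * z)
  have h2 := ((Equiv.prodComm ℕ+ ℕ+).hasSum_iff.2 (summable_cotTerm hk hz').hasSum).mul_left
    (z ^ (2 * k) * (2 * (-1 / z)))
  have h3 : HasSum (fun a : ℕ+ × ℕ+ => -2 * ∑ j ∈ range k, z ^ (2 * j + 1) *
        (1 / (a.1 : ℂ) ^ (2 * (k - j)) * (1 / (a.2 : ℂ) ^ (2 * (j + 1)))))
      (-2 * ∑ j ∈ range k, z ^ (2 * j + 1) *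
        (riemannZeta (2 * (k - j) : ℕ) * riemannZeta (2 * (j + 1) : ℕ))) :=
    (hasSum_sum fun j hj => (hasSum_one_div_mul_one_div
      (by have := mem_range.1 hj; omega) (by omega)).mul_left _).mul_left _
  have h4 := (h1.sub h2).unique (h3.congr_fun fun a => cotTerm_add_cotTerm k hz a)
  rw [cotSeries_eq_tsum hk hz, cotSeries_eq_tsum hk hz', zetaSum_eq k z]
  have h5 : z ^ (2 * k) * (riemannZeta (2 * k + 2 : ℕ) / (-1 / z)) =
      -(riemannZeta (2 * k + 2 : ℕ) * z ^ (2 * k + 1)) := by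
    field_simp
    ring
  linear_combination h4 - h5

theorem riemannZeta_two_mul_eq (m : ℕ) :
    riemannZeta (2 * m : ℕ) = -(1 / 2) * (2 * (Real.pi : ℂ) * Complex.I) ^ (2 * m) *
      (((bernoulli (2 * m) : ℚ) : ℂ) / ((2 * m).factorial : ℂ)) := by
  push_cast
  rw [riemannZeta_two_mul_nat', mul_pow, mul_pow, pow_mul Complex.I, Complex.I_sq,
    zpow_sub₀ two_ne_zero, zpow_one, pow_succ,
    show (2 : ℂ) ^ (2 * (m : ℤ)) = 2 ^ (2 * m) from mod_cast zpow_natCast (2 : ℂ) (2 * m)]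
  ring

/-- Euler's formula for even zeta values, valid also at argument 0, is applied to both factors. -/
theorem bernoulliP_eq (k : ℕ) (z : ℂ) :
    Real.pi * Complex.I * bernoulliP k z = -zetaSum k z := by
  rw [bernoulliP, zetaSum, mul_sum, mul_sum, ← sum_neg_distrib]
  refine sum_congr rfl fun m hm => ?_
  have hm := mem_range.1 hm
  rw [riemannZeta_two_mul_eq, riemannZeta_two_mul_eq,
    show 2 * k + 2 - 2 * m = 2 * (k + 1 - m) by omega]
  obtain ⟨d, hd⟩ := Nat.exists_eq_add_of_le (show m ≤ k + 1 by omega)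
  rw [show k + 1 - m = d by omega]
  have e : (2 * (Real.pi : ℂ) * Complex.I) ^ (2 * m) * (2 * (Real.pi : ℂ) * Complex.I) ^ (2 * d) =
      (2 * (Real.pi : ℂ) * Complex.I) ^ (2 * k + 1) * (2 * (Real.pi : ℂ) * Complex.I) := by
    rw [← pow_add, ← pow_succ]
    congr 1
    omega
  linear_combination (1 / 4) * (((bernoulli (2 * m) : ℚ) : ℂ) / ((2 * m).factorial : ℂ)) *
    (((bernoulli (2 * d) : ℚ) : ℂ) / ((2 * d).factorial : ℂ)) * z ^ (2 * (m : ℤ) - 1) * e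

/-- The reflection `m ↦ k + 1 - m` exchanges the zeta factors; the sign arises because all exponents
are odd. -/
theorem zetaSum_neg_one_div (k : ℕ) {z : ℂ} (hz : z ≠ 0) :
    z ^ (2 * k) * zetaSum k (-1 / z) = -zetaSum k z := by
  rw [zetaSum, ← sum_range_reflect, zetaSum, mul_sum, ← sum_neg_distrib]
  refine sum_congr rfl fun m hm => ?_
  have hm := mem_range.1 hm
  obtain ⟨d, hd⟩ := Nat.exists_eq_add_of_le (show m ≤ k + 1 by omega)
  rw [show k + 2 - 1 - m = d by omega, show k + 1 - d = m by omega, show k + 1 - m = d by omega]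
  have h1 : (-1 / z) ^ (2 * (d : ℤ) - 1) = -(z ^ (2 * (d : ℤ) - 1))⁻¹ := by
    rw [div_zpow, Odd.neg_one_zpow ⟨(d : ℤ) - 1, by ring⟩, neg_div, one_div]
  have h2 : z ^ (2 * k) * (z ^ (2 * (d : ℤ) - 1))⁻¹ = z ^ (2 * (m : ℤ) - 1) := by
    rw [← zpow_natCast, ← zpow_neg, ← zpow_add₀ hz]
    congr 1
    push_cast
    omega
  rw [h1, ← h2]
  ring

/-- Ramanujan's formula, symmetrized. -/
theorem lambert_inversion {k : ℕ} (hk : 1 ≤ k) {z : ℂ} (hz : 0 < z.im) :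
    lambert k (nome z) + 1 / 2 * bernoulliP k z + 1 / 2 * riemannZeta (2 * k + 1 : ℕ) =
      z ^ (2 * k) * (lambert k (nome (-1 / z)) + 1 / 2 * bernoulliP k (-1 / z) +
        1 / 2 * riemannZeta (2 * k + 1 : ℕ)) := by
  have hz0 : z ≠ 0 := fun h => by simp [h] at hz
  have h1 := cotSeries_sub hk hz
  rw [cotSeries_eq_lambert hk hz, cotSeries_eq_lambert hk (neg_one_div_im_pos hz)] at h1
  have hpi : (2 * (Real.pi * Complex.I) : ℂ) ≠ 0 := by
    simp [Real.pi_ne_zero, Complex.I_ne_zero]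
  apply mul_left_cancel₀ hpi
  -- By antisymmetry, half of `bernoulliP` changes under inversion by the whole of it, which is the
  -- defect of the Lambert series together with its zeta constant.
  linear_combination -h1 + bernoulliP_eq k z - z ^ (2 * k) * bernoulliP_eq k (-1 / z) +
    zetaSum_neg_one_div k hz0

/-! ### The q-bracket of the weighted hook functions -/

/-- The weight of a hook number in `hookFun a t`. -/
noncomputable def hookWeight (a : ℂ) (t h : ℕ) : ℂ :=
  if t ∣ h then (t : ℂ) ^ (a - 1) * (1 / (h : ℂ) ^ a) else 0

theorem hookFun_eq (a : ℂ) (t : ℕ) (p : AllPartitions) :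
    hookFun a t p = ((hooks p.2).map (hookWeight a t)).sum := by
  rw [hookFun, tHooks, ← Multiset.sum_map_mul_left]
  induction hooks p.2 using Multiset.induction_on with
  | empty => simp
  | cons h s ih => by_cases hd : t ∣ h <;> simp [hookWeight, hd, ← ih]

theorem hookWeight_natCast (k t h : ℕ) :
    hookWeight (2 * (k : ℂ) + 2) t h =
      if t ∣ h then (t : ℂ) ^ (2 * k + 1) * (1 / (h : ℂ) ^ (2 * k + 2)) else 0 := by
  rw [hookWeight, show (2 * (k : ℂ) + 2) - 1 = ((2 * k + 1 : ℕ) : ℂ) by push_cast; ring,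
    show (2 * (k : ℂ) + 2) = ((2 * k + 2 : ℕ) : ℂ) by push_cast; ring, Complex.cpow_natCast,
    Complex.cpow_natCast]

theorem norm_hookWeight_le (k t h : ℕ) :
    ‖hookWeight (2 * (k : ℂ) + 2) t h‖ ≤ (t : ℝ) ^ (2 * k + 1) := by
  rw [hookWeight_natCast]
  split_ifs
  · rw [norm_mul, norm_pow, Complex.norm_natCast]
    exact mul_le_of_le_one_right (by positivity) (norm_one_div_natCast_pow_le_one _ _)
  · rw [norm_zero]
    positivity

theorem tsum_hookWeight (k : ℕ) {t : ℕ} (ht : 1 ≤ t) (q : ℂ) :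
    ∑' h : ℕ, hookWeight (2 * (k : ℂ) + 2) t h * (h * (q ^ h / (1 - q ^ h))) =
      lambert k (q ^ t) := by
  have hinj : Function.Injective fun m : ℕ => t * m := fun a b h =>
    Nat.eq_of_mul_eq_mul_left ht h
  rw [lambert, ← hinj.tsum_eq]
  · refine tsum_congr fun m => ?_
    rw [hookWeight_natCast, if_pos (dvd_mul_right t m), pow_mul]
    rcases Nat.eq_zero_or_pos m with rfl | hm
    · simp
    have ht0 : (t : ℂ) ≠ 0 := by exact_mod_cast (by omega : t ≠ 0)
    have hm0 : (m : ℂ) ≠ 0 := by exact_mod_cast hm.ne'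
    push_cast
    -- The normalization `t^(a-1)` in `hookFun` is exactly what cancels every power of `t` here.
    have : (t : ℂ) ^ (2 * k + 1) * (1 / ((t : ℂ) * m) ^ (2 * k + 2)) * (t * m) =
        1 / (m : ℂ) ^ (2 * k + 1) := by
      rw [mul_pow, pow_succ (t : ℂ) (2 * k + 1), pow_succ (m : ℂ) (2 * k + 1)]
      field_simp
    rw [← mul_assoc, this]
  · intro h hh
    by_contra hd
    refine hh ?_
    have : ¬ t ∣ h := fun ⟨m, hm⟩ => hd ⟨m, hm.symm⟩
    simp only
    rw [hookWeight_natCast, if_neg this, zero_mul]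

theorem hasSum_hookFun (k : ℕ) {t : ℕ} (ht : 1 ≤ t) {q : ℂ} (hq : ‖q‖ < 1) :
    HasSum (fun p : AllPartitions => hookFun (2 * (k : ℂ) + 2) t p * q ^ p.1)
      (lambert k (q ^ t) * ∑' p : AllPartitions, q ^ p.1) := by
  rw [← tsum_hookWeight k ht]
  simp only [hookFun_eq]
  exact hasSum_hook_weights (norm_hookWeight_le k t) hq

theorem qBracket_hookFun (k : ℕ) {t : ℕ} (ht : 1 ≤ t) {q : ℂ} (hq : ‖q‖ < 1) :
    qBracket (hookFun (2 * (k : ℂ) + 2) t) q = lambert k (q ^ t) := by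
  rw [qBracket, (hasSum_hookFun k ht hq).tsum_eq,
    mul_div_cancel_right₀ _ (tsum_allPartitions_pow_ne_zero hq)]

theorem hookM_eq (k : ℕ) {t : ℕ} (ht : 1 ≤ t) {z : ℂ} (hz : 0 < z.im) :
    hookM k t z = lambert k (nome (t * z)) + 1 / 2 * bernoulliP k (t * z) +
      1 / 2 * riemannZeta (2 * k + 1 : ℕ) := by
  rw [hookM, qBracket_hookFun k ht (norm_nome_lt_one hz), nome_natCast_mul]
  push_cast
  rfl

theorem nome_natCast_mul_add_one (t : ℕ) (z : ℂ) : nome (t * (z + 1)) = nome (t * z) := by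
  rw [nome_natCast_mul, nome_add_one, nome_natCast_mul]

theorem add_one_pow_sub_pow {R : Type*} [CommRing R] (z : R) (n : ℕ) :
    (z + 1) ^ n - z ^ n = ∑ r ∈ Icc 1 n, (n.choose r : R) * z ^ (n - r) := by
  rw [add_comm, add_pow, range_eq_Ico, sum_eq_sum_Ico_succ_bot (by omega)]
  simp only [one_pow, one_mul, zero_add, Nat.choose_zero_right, Nat.cast_one, mul_one, Nat.sub_zero,
    add_sub_cancel_left]
  exact sum_congr rfl fun r _ => mul_comm _ _

/-- The `m = 0` term is a multiple of `1/(tz)` and yields the rational correction; all other terms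
are powers with natural exponents and expand binomially. -/
theorem bernoulliP_mul_add_one_sub (k : ℕ) {t : ℂ} {z : ℂ} (ht : t ≠ 0) (hz : z ≠ 0)
    (hz1 : z + 1 ≠ 0) :
    bernoulliP k (t * (z + 1)) - bernoulliP k (t * z) =
      -(1 / 2) * (2 * (Real.pi : ℂ) * Complex.I) ^ (2 * k + 1) *
        ((∑ m ∈ Icc 1 (k + 1), ∑ r ∈ Icc 1 (2 * m - 1),
          ((bernoulli (2 * m) : ℚ) : ℂ) / ((2 * m).factorial : ℂ) *
          (((bernoulli (2 * k + 2 - 2 * m) : ℚ) : ℂ) / ((2 * k + 2 - 2 * m).factorial : ℂ)) *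
          t ^ (2 * m - 1) * ((2 * m - 1).choose r : ℂ) * z ^ (2 * m - 1 - r)) -
        ((bernoulli (2 * k + 2) : ℚ) : ℂ) / ((2 * k + 2).factorial : ℂ) *
          (1 / (t * z * (z + 1)))) := by
  rw [bernoulliP, bernoulliP, ← mul_sub, ← sum_sub_distrib, range_eq_Ico,
    sum_eq_sum_Ico_succ_bot (by omega), zero_add,
    show Ico 1 (k + 2) = Icc 1 (k + 1) from rfl, sub_eq_neg_add _ (_ * (1 / _))]
  refine congrArg _ (congrArg₂ (· + ·) ?_ (sum_congr rfl fun m hm => ?_))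
  · simp only [mul_zero, Nat.cast_zero, zero_sub, zpow_neg_one, Nat.sub_zero, bernoulli_zero,
      Nat.factorial_zero, Nat.cast_one, Rat.cast_one]
    field_simp
    ring
  · have hm := (mem_Icc.1 hm).1
    rw [show 2 * (m : ℤ) - 1 = ((2 * m - 1 : ℕ) : ℤ) by omega, zpow_natCast, zpow_natCast,
      ← mul_sub, mul_pow, mul_pow, ← mul_sub, add_one_pow_sub_pow, mul_sum, mul_sum]
    exact sum_congr rfl fun r _ => by ring

end HookBracket

theorem theorem1p3 (k t : ℕ) (hk : 1 ≤ k) (ht : 1 ≤ t) (z : ℂ) (hz : 0 < z.im) :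
    -- the two series in the `q`-bracket converge absolutely and the denominator does not vanish
    (Summable (fun p : HookBracket.AllPartitions => HookBracket.nome z ^ p.1) ∧
      Summable (fun p : HookBracket.AllPartitions =>
        HookBracket.hookFun (2 * (k : ℂ) + 2) t p * HookBracket.nome z ^ p.1) ∧
      (∑' p : HookBracket.AllPartitions, HookBracket.nome z ^ p.1) ≠ 0) ∧
    -- translation
    (HookBracket.hookM k t (z + 1) - HookBracket.hookM k t z =
      -(1 / 4) * (2 * (Real.pi : ℂ) * Complex.I) ^ (2 * k + 1) *
        ((∑ m ∈ Finset.Icc 1 (k + 1), ∑ r ∈ Finset.Icc 1 (2 * m - 1),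
          ((bernoulli (2 * m) : ℚ) : ℂ) / ((2 * m).factorial : ℂ) *
          (((bernoulli (2 * k + 2 - 2 * m) : ℚ) : ℂ) / ((2 * k + 2 - 2 * m).factorial : ℂ)) *
          (t : ℂ) ^ (2 * m - 1) * ((2 * m - 1).choose r : ℂ) * z ^ (2 * m - 1 - r)) -
        ((bernoulli (2 * k + 2) : ℚ) : ℂ) / ((2 * k + 2).factorial : ℂ) *
          (1 / ((t : ℂ) * z * (z + 1))))) ∧
    -- inversion
    HookBracket.hookM k t z =
      ((t : ℂ) * z) ^ (2 * k) * HookBracket.hookM k t (-1 / ((t : ℂ) ^ 2 * z)) := by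
  have ht0 : (t : ℂ) ≠ 0 := by exact_mod_cast (by omega : t ≠ 0)
  have htr : (0 : ℝ) < t := by exact_mod_cast ht
  have hz0 : z ≠ 0 := fun h => by simp [h] at hz
  have hz1 : 0 < (z + 1).im := by simpa using hz
  have hz1' : z + 1 ≠ 0 := fun h => by simp [h] at hz1
  have htz : 0 < ((t : ℂ) * z).im := by simpa using mul_pos htr hz
  have hq := HookBracket.norm_nome_lt_one hz
  refine ⟨⟨HookBracket.summable_allPartitions_pow hq, (HookBracket.hasSum_hookFun k ht hq).summable,
    HookBracket.tsum_allPartitions_pow_ne_zero hq⟩, ?_, ?_⟩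
  · rw [HookBracket.hookM_eq k ht hz1, HookBracket.hookM_eq k ht hz,
      HookBracket.nome_natCast_mul_add_one]
    linear_combination (1 / 2) * HookBracket.bernoulliP_mul_add_one_sub k ht0 hz0 hz1'
  -- In the variable `tz`, the map `z ↦ -1/(t²z)` becomes the plain inversion.
  · have e : (t : ℂ) * (-1 / ((t : ℂ) ^ 2 * z)) = -1 / (t * z) := by
      field_simp
    have him : 0 < (-1 / ((t : ℂ) ^ 2 * z)).im := by
      refine HookBracket.neg_one_div_im_pos ?_
      have : ((t : ℂ) ^ 2 * z).im = (t : ℝ) ^ 2 * z.im := by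
        rw [← Complex.im_ofReal_mul]
        push_cast
        rfl
      rw [this]
      positivity
    rw [HookBracket.hookM_eq k ht hz, HookBracket.hookM_eq k ht him, e]
    exact HookBracket.lambert_inversion hk htz
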